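/- Let $n \ge 0$ be an integer, let $p = 1$ or $p = \infty$, and let $f:\mathbb{R}^n \to \mathbb{R}^n$ be a real analytic map that is nonexpansive for the $p$-norm, that is, $\|f(x)-f(y)\|_p \le \|x-y\|_p$ for all $x, y \in \mathbb{R}^n$, where $\|x\|_1 = \sum_i |x_i|$ and $\|x\|_\infty = \max_i |x_i|$. Suppose that $f$ has at least one fixed point. Then there is an integer $q \ge 1$ such that: (i) for each $x \in \mathbb{R}^n$, the sequence $(f^{kq}(x))_{k \ge 0}$ converges, where $f^m$ denotes the $m$-th iterate of $f$; (ii) for each $x \in \mathbb{R}^n$, the limit $\xi$ of $(f^{kq}(x))_{k \ge 0}$ is a periodic point of $f$ (that is, $f^m(\xi) = \xi$ for some $m \ge 1$), and its minimal period, the least such $m$, divides $q$; (iii) there is a permutation $\pi$ of $n$ letters such that $q$ is equal to the order of $\pi$ or to twice the order of $\pi$. -/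

import Mathlib

open Filter Topology
open scoped ENNReal

/-!
Let `v` be a fixed point of `f` and `A = f'(v)`, a linear contraction for the `p`-norm. The exponent
`q = 2 * orderOf π` is read off from `A` alone, and analyticity carries it to all of `f`.

*Linear part.* Both norms are controlled by `n` functionals up to sign: the coordinates when
`p = ∞`, and, after passing to the adjoint of `A`, the evaluations at the basis vectors when
`p = 1`. A limit `R` of powers of a contraction has a range on which the contraction is a surjective
isometry. If `n` functionals compute the norm, keep a minimal set of them that still does; each
survivor is then the only one that computes the norm near some vector, so a surjective linear
isometry permutes the survivors up to sign
(`LinearMap.exists_perm_pow_two_mul_orderOf_eq_one`). Twice the order of this permutation `π` makes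
the isometry trivial, and the powers of `A ^ (2 * orderOf π)` converge.

*Nonlinear part.* Put `g = f^[q]` and `B = A ^ q`, so that the powers of `B` converge pointwise to
some `P`. Let `ξ` be a cluster point of an orbit of `g`. It is recurrent, and its orbit `z k` has
steps of constant length `δ`, with unit directions `u k`. The crux is that `δ = 0`
(`eq_zero_of_forall_norm_step_eq_of_recurrent`). If a norming functional `φ` has `φ (u (k + m)) = 1`,
then `φ ∘ g^[m]` is analytic, 1-Lipschitz and has slope one on the segment `[z k, z (k + 1)]`, hence
has slope one on the whole line through it. Far out on that line, the distance to the fixed point is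
`‖z k + s • u k - v‖ = s + a k`, where the levels `a k` do not increase with `k`, and by recurrence
are eventually constant. So `g^[m]` preserves the distance from `v` to far points of the line, as
seen by a norming functional `Φ (k + m)`; the same then holds infinitesimally at `v`, which gives
`Φ (k + m) (B ^ m (u k)) = 1`. There are only finitely many norming functionals, so as `m` tends to
infinity some `φ` satisfies `φ (P (u k)) = 1` for all large `k`. Thus `φ ∘ P` grows by `δ` at each
step of a bounded orbit, and `δ = 0`. Consequently `ξ` is fixed by `g`, and the whole orbit
converges to it.
-/

/-! ### Linear isometries of norms given by finitely many functionals -/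

/-- If near a point the space is covered by the kernels of finitely many functionals, then one of
them vanishes: restricting to lines through the point extends the cover to the whole space, which is
not a finite union of proper subspaces. -/
theorem exists_eq_zero_of_eventually_exists {κ W : Type*} [Finite κ] [NormedAddCommGroup W]
    [NormedSpace ℝ W] (l : κ → W →ₗ[ℝ] ℝ) (w : W) (h : ∀ᶠ v in 𝓝 w, ∃ j, l j v = 0) :
    ∃ j, l j = 0 := by
  classical
  have := Fintype.ofFinite κ
  have key : ∀ v, ∃ j, l j v = 0 := by
    intro v
    have hc : Tendsto (fun t : ℝ => w + t • v) (𝓝[≠] 0) (𝓝 w) := by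
      have : Continuous fun t : ℝ => w + t • v := by fun_prop
      simpa using (this.tendsto 0).mono_left nhdsWithin_le_nhds
    obtain ⟨j, hj⟩ := frequently_exists.1 (hc.eventually h).frequently
    refine ⟨j, ?_⟩
    obtain ⟨t, ht, ht0⟩ := (hj.and_eventually self_mem_nhdsWithin).exists
    have hne : ∀ᶠ s : ℝ in 𝓝[≠] 0, s ≠ t :=
      nhdsWithin_le_nhds (isOpen_ne.mem_nhds (Ne.symm ht0))
    obtain ⟨s, hs, hst⟩ := (hj.and_eventually hne).exists
    simp only [map_add, map_smul, smul_eq_mul] at ht hs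
    have : (s - t) * l j v = 0 := by linarith
    exact (mul_eq_zero.1 this).resolve_left (sub_ne_zero.2 hst)
  have htop : (⊤ : Submodule ℝ W) ∈ Finset.univ.image fun j => LinearMap.ker (l j) := by
    apply Subspace.top_mem_of_biUnion_eq_univ
    refine Set.eq_univ_of_forall fun v => ?_
    obtain ⟨j, hj⟩ := key v
    simpa using ⟨j, hj⟩
  obtain ⟨j, -, hj⟩ := Finset.mem_image.1 htop
  exact ⟨j, LinearMap.ker_eq_top.1 hj⟩

theorem LinearMap.eq_or_eq_neg_of_forall_abs_eq {W : Type*} [NormedAddCommGroup W] [NormedSpace ℝ W]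
    {a b : W →ₗ[ℝ] ℝ} (h : ∀ w, |a w| = |b w|) : a = b ∨ a = -b := by
  obtain ⟨j, hj⟩ := exists_eq_zero_of_eventually_exists
    (fun j : Bool => if j then a - b else a + b) 0 <| Eventually.of_forall fun v => by
      rcases abs_eq_abs.1 (h v) with h | h
      · exact ⟨true, by simp [h]⟩
      · exact ⟨false, by simp [h]⟩
  cases j
  · exact Or.inr (eq_neg_of_add_eq_zero_left (by simpa using hj))
  · exact Or.inl (sub_eq_zero.1 (by simpa using hj))

/-- A surjective linear isometry of a space whose norm is the maximum of the `|e i|` has finite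
order, dividing twice the order of a permutation of the index set. The permutation acts on a minimal
set of indices that suffices for the norm, and fixes the other indices. -/
theorem LinearMap.exists_perm_pow_two_mul_orderOf_eq_one {ι W : Type*} [Fintype ι]
    [NormedAddCommGroup W] [NormedSpace ℝ W] (e : ι → W →L[ℝ] ℝ)
    (hle : ∀ i w, |e i w| ≤ ‖w‖) (hatt : ∀ w, w ≠ 0 → ∃ i, |e i w| = ‖w‖)
    (A : W →ₗ[ℝ] W) (hA : ∀ w, ‖A w‖ = ‖w‖) (hsurj : Function.Surjective A) :
    ∃ π : Equiv.Perm ι, A ^ (2 * orderOf π) = 1 := by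
  classical
  have hAc : Continuous A := (AddMonoidHomClass.isometry_of_norm A hA).continuous
  obtain ⟨T, hT⟩ := exists_minimal_of_wellFoundedLT
    (fun T : Finset ι => ∀ w, w ≠ 0 → ∃ i ∈ T, |e i w| = ‖w‖)
    ⟨Finset.univ, fun w hw => by simpa using hatt w hw⟩
  -- By minimality each `i ∈ T` is the only index of `T` that computes the norm of some vector.
  have hexp : ∀ i ∈ T, ∃ w, ∀ j ∈ T, j ≠ i → |e j w| < ‖w‖ := by
    intro i hi
    have h : ¬ ∀ w, w ≠ 0 → ∃ j ∈ T.erase i, |e j w| = ‖w‖ := fun h =>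
      Finset.notMem_erase i T (hT.2 h (Finset.erase_subset i T) hi)
    push Not at h
    obtain ⟨w, -, hw⟩ := h
    exact ⟨w, fun j hj hji => lt_of_le_of_ne (hle j w) (hw j (Finset.mem_erase.2 ⟨hji, hj⟩))⟩
  have hattT : ∀ i ∈ T, ∀ w, (∀ j ∈ T, j ≠ i → |e j w| < ‖w‖) → |e i w| = ‖w‖ := by
    intro i hi w hw
    rcases eq_or_ne w 0 with rfl | h0
    · simp
    obtain ⟨j, hj, hjw⟩ := hT.1 w h0
    by_cases hji : j = i
    · exact hji ▸ hjw
    · exact absurd hjw (hw j hj hji).ne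
  have huniq : ∀ i ∈ T, ∀ j ∈ T, (∀ w, |e i w| = |e j w|) → i = j := by
    intro i hi j hj h
    by_contra hij
    obtain ⟨w, hw⟩ := hexp i hi
    have h1 := hattT i hi w hw
    have h2 := hw j hj (Ne.symm hij)
    rw [← h w, h1] at h2
    exact lt_irrefl _ h2
  have hstep : ∀ i ∈ T, ∃ j ∈ T, ∀ w, |e i (A w)| = |e j w| := by
    intro i hi
    obtain ⟨w, hw⟩ := hexp i hi
    obtain ⟨w, rfl⟩ := hsurj w
    have hnear : ∀ᶠ v in 𝓝 w, ∀ j ∈ T, j ≠ i → |e j (A v)| < ‖A v‖ := by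
      refine (Finset.eventually_all T).2 fun j hj => ?_
      by_cases hji : j = i
      · simp [hji]
      · have := (((e j).continuous.comp hAc).abs.tendsto w).eventually_lt
          (hAc.norm.tendsto w) (hw j hj hji)
        filter_upwards [this] with v hv _ using hv
    -- Near `w` the norm is `|e i ∘ A|`, so the kernels of the `e i ∘ A ∓ e j` cover a neighbourhood.
    obtain ⟨⟨j, s⟩, hj⟩ := exists_eq_zero_of_eventually_exists
      (fun j : T × Bool => if j.2 then (e i).toLinearMap ∘ₗ A - (e j.1).toLinearMap
        else (e i).toLinearMap ∘ₗ A + (e j.1).toLinearMap) w <| by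
      filter_upwards [hnear] with v hv
      have h1 := hattT i hi (A v) hv
      rcases eq_or_ne v 0 with rfl | h0
      · exact ⟨(⟨i, hi⟩, true), by simp⟩
      obtain ⟨j, hj, hjv⟩ := hT.1 v h0
      rw [hA, ← hjv] at h1
      rcases abs_eq_abs.1 h1 with h | h
      · exact ⟨(⟨j, hj⟩, true), by simp [h]⟩
      · exact ⟨(⟨j, hj⟩, false), by simp [h]⟩
    refine ⟨j, j.2, fun v => ?_⟩
    have hjv := LinearMap.congr_fun hj v
    cases s
    · have : e i (A v) + e j v = 0 := by simpa using hjv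
      rw [eq_neg_of_add_eq_zero_left this, abs_neg]
    · have : e i (A v) - e j v = 0 := by simpa using hjv
      rw [sub_eq_zero.1 this]
  choose! τ hτT hτ using hstep
  set σ : ι → ι := fun i => if i ∈ T then τ i else i with hσ
  have hσinj : Function.Injective σ := by
    intro i j hij
    by_cases hi : i ∈ T <;> by_cases hj : j ∈ T <;> simp only [hσ, hi, hj, if_true, if_false] at hij
    · refine huniq i hi j hj fun w => ?_
      obtain ⟨w, rfl⟩ := hsurj w
      rw [hτ i hi, hτ j hj, hij]
    · exact absurd (hij ▸ hτT i hi) hj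
    · exact absurd (hij.symm ▸ hτT j hj) hi
    · exact hij
  set π : Equiv.Perm ι := Equiv.ofBijective σ hσinj.bijective_of_finite with hπ
  have hπT : ∀ i ∈ T, π i = τ i := fun i hi => by simp [hπ, hσ, hi]
  have hpow : ∀ m : ℕ, ∀ i ∈ T, (π ^ m) i ∈ T ∧ ∀ w, |e i ((A ^ m) w)| = |e ((π ^ m) i) w| := by
    intro m
    induction m with
    | zero => simp
    | succ m ih =>
      intro i hi
      obtain ⟨h1, h2⟩ := ih i hi
      rw [pow_succ' π, Equiv.Perm.mul_apply, hπT _ h1]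
      refine ⟨hτT _ h1, fun w => ?_⟩
      rw [pow_succ, Module.End.mul_apply, h2, hτ _ h1]
  refine ⟨π, LinearMap.ext fun w => ?_⟩
  -- `e i ∘ A ^ orderOf π = ± e i` with a sign that does not depend on the vector.
  have hfix : ∀ i ∈ T, e i ((A ^ (2 * orderOf π)) w) = e i w := by
    intro i hi
    have h := (hpow (orderOf π) i hi).2
    rw [pow_orderOf_eq_one, Equiv.Perm.one_apply] at h
    rw [two_mul, pow_add, Module.End.mul_apply]
    rcases LinearMap.eq_or_eq_neg_of_forall_abs_eq (a := (e i).toLinearMap ∘ₗ (A ^ orderOf π))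
      (b := (e i).toLinearMap) h with h | h
    · have h' : ∀ v, e i ((A ^ orderOf π) v) = e i v := fun v => LinearMap.congr_fun h v
      rw [h', h']
    · have h' : ∀ v, e i ((A ^ orderOf π) v) = -e i v := fun v => LinearMap.congr_fun h v
      rw [h', h', neg_neg]
  by_contra hne
  obtain ⟨i, hi, hi'⟩ := hT.1 _ (sub_ne_zero.2 hne)
  rw [map_sub, hfix i hi, Module.End.one_apply, sub_self, abs_zero] at hi'
  exact hne (sub_eq_zero.1 (norm_eq_zero.1 hi'.symm))

/-! ### Powers of linear contractions -/

theorem tendsto_of_antitone_of_subseq {X : Type*} [NormedAddCommGroup X] {u : ℕ → X} {y : X}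
    (hanti : Antitone fun k => ‖u k - y‖) {θ : ℕ → ℕ}
    (h : Tendsto (u ∘ θ) atTop (𝓝 y)) : Tendsto u atTop (𝓝 y) := by
  rw [Metric.tendsto_atTop] at h ⊢
  intro ε hε
  obtain ⟨N, hN⟩ := h ε hε
  refine ⟨θ N, fun k hk => ?_⟩
  have := hN N le_rfl
  rw [dist_eq_norm] at this ⊢
  exact (hanti hk).trans_lt this

/-- For a contraction `L` of a norm given by the `|e i|`, some power `L ^ (2 * orderOf π)` has
convergent powers. The limit is a limit point `R` of powers of `L` whose exponents are multiples of
every `2 * orderOf π`. -/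
theorem ContinuousLinearMap.exists_perm_forall_tendsto_pow {ι V : Type*} [Fintype ι]
    [NormedAddCommGroup V] [NormedSpace ℝ V] [FiniteDimensional ℝ V] (e : ι → V →L[ℝ] ℝ)
    (hle : ∀ i w, |e i w| ≤ ‖w‖) (hatt : ∀ w, w ≠ 0 → ∃ i, |e i w| = ‖w‖)
    (L : V →L[ℝ] V) (hL : ∀ v, ‖L v‖ ≤ ‖v‖) :
    ∃ π : Equiv.Perm ι, ∀ v, ∃ y,
      Tendsto (fun k => ((L ^ (2 * orderOf π)) ^ k) v) atTop (𝓝 y) := by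
  classical
  have hpow : ∀ m v, ‖(L ^ m) v‖ ≤ ‖v‖ := by
    intro m
    induction m with
    | zero => simp
    | succ m ih =>
      intro v
      rw [pow_succ, mul_apply_eq_comp]
      exact (ih _).trans (hL v)
  have hanti : ∀ v, Antitone fun k => ‖(L ^ k) v‖ := fun v => antitone_nat_of_succ_le fun k => by
    rw [pow_succ', mul_apply_eq_comp]
    exact hL _
  -- `2 * orderOf π` divides this exponent for every permutation `π`.
  set Q := 2 * Fintype.card (Equiv.Perm ι)
  have : ProperSpace (V →L[ℝ] V) := FiniteDimensional.proper ℝ _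
  obtain ⟨R, -, θ, hθ, hR⟩ := tendsto_subseq_of_bounded
    (Metric.isBounded_closedBall (x := (0 : V →L[ℝ] V)) (r := 1)) (x := fun l => L ^ (Q * l))
    fun l => by
      rw [mem_closedBall_zero_iff]
      exact ContinuousLinearMap.opNorm_le_bound _ zero_le_one fun v => by simpa using hpow _ v
  have hRv : ∀ v, Tendsto (fun l => (L ^ (Q * θ l)) v) atTop (𝓝 (R v)) := fun v =>
    ((ContinuousLinearMap.apply ℝ V v).continuous.tendsto R).comp hR
  have hQ : Tendsto (fun l => Q * θ l) atTop atTop :=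
    hθ.tendsto_atTop.const_mul_atTop' (by positivity)
  have hcomm : ∀ m v, (L ^ m) (R v) = R ((L ^ m) v) := fun m v =>
    tendsto_nhds_unique (((L ^ m).continuous.tendsto _).comp (hRv v)) <| by
      refine (hRv ((L ^ m) v)).congr fun l => ?_
      simp only [Function.comp_apply]
      rw [← mul_apply_eq_comp, ← mul_apply_eq_comp, ← pow_add, ← pow_add,
        add_comm]
  -- Both norms are the limit of the nonincreasing sequence `‖(L ^ k) v‖`.
  have hiso : ∀ v, ‖L (R v)‖ = ‖R v‖ := by
    intro v
    have hlim := tendsto_atTop_ciInf (hanti v) ⟨0, by rintro _ ⟨k, rfl⟩; exact norm_nonneg _⟩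
    have h1 := tendsto_nhds_unique (hlim.comp hQ) (hRv v).norm
    have h2 := tendsto_nhds_unique (hlim.comp ((tendsto_add_atTop_nat 1).comp hQ))
      ((((L.continuous.tendsto _).comp (hRv v)).norm).congr fun l => by
        simp only [Function.comp_apply, pow_succ' L, mul_apply_eq_comp])
    rw [← h1, ← h2]
  set W := LinearMap.range R.toLinearMap
  have hmap : ∀ w ∈ W, L.toLinearMap w ∈ W := by
    rintro _ ⟨v, rfl⟩
    exact ⟨L v, by simpa using (hcomm 1 v).symm⟩
  set A : W →ₗ[ℝ] W := L.toLinearMap.restrict hmap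
  have hA : ∀ w, ‖A w‖ = ‖w‖ := by
    rintro ⟨_, v, rfl⟩
    exact hiso v
  have hinj : Function.Injective A := (AddMonoidHomClass.isometry_of_norm A hA).injective
  obtain ⟨π, hπ⟩ := LinearMap.exists_perm_pow_two_mul_orderOf_eq_one
    (fun i => (e i).comp W.subtypeL) (fun i w => hle i w)
    (fun w hw => hatt w (by simpa using hw)) A hA (LinearMap.injective_iff_surjective.1 hinj)
  refine ⟨π, fun v => ⟨R v, ?_⟩⟩
  have hfix : (L ^ (2 * orderOf π)) (R v) = R v := by
    have hApow : ∀ m, ∀ w : W, ((A ^ m) w : V) = (L ^ m) w := by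
      intro m
      induction m with
      | zero => simp
      | succ m ih =>
        intro w
        rw [pow_succ, Module.End.mul_apply, ih, pow_succ, mul_apply_eq_comp]
        rfl
    have := hApow (2 * orderOf π) ⟨R v, v, rfl⟩
    rw [hπ] at this
    exact this.symm
  obtain ⟨d, hd⟩ : 2 * orderOf π ∣ Q := Nat.mul_dvd_mul_left 2 orderOf_dvd_card
  refine tendsto_of_antitone_of_subseq (θ := fun l => d * θ l)
    (antitone_nat_of_succ_le fun k => ?_) ?_
  · calc _ = ‖(L ^ (2 * orderOf π)) (((L ^ (2 * orderOf π)) ^ k) v - R v)‖ := by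
          rw [map_sub, hfix, pow_succ', mul_apply_eq_comp]
      _ ≤ _ := hpow _ _
  · refine (hRv v).congr fun l => ?_
    simp only [Function.comp_apply]
    rw [← pow_mul, ← mul_assoc, ← hd]

theorem exists_perm_forall_tendsto_pow_of_linfty {n : ℕ}
    (L : PiLp ∞ (fun _ : Fin n => ℝ) →L[ℝ] PiLp ∞ (fun _ : Fin n => ℝ))
    (hL : ∀ v, ‖L v‖ ≤ ‖v‖) :
    ∃ π : Equiv.Perm (Fin n), ∀ v, ∃ y,
      Tendsto (fun k => ((L ^ (2 * orderOf π)) ^ k) v) atTop (𝓝 y) := by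
  refine L.exists_perm_forall_tendsto_pow (fun i => PiLp.proj ∞ (fun _ : Fin n => ℝ) i)
    (fun i w => PiLp.norm_apply_le w i) (fun w hw => ?_) hL
  have : Nonempty (Fin n) := by
    by_contra h
    rw [not_nonempty_iff] at h
    exact hw (Subsingleton.elim _ _)
  obtain ⟨i, hi⟩ := exists_eq_ciSup_of_finite (f := fun i => ‖w i‖)
  exact ⟨i, by rw [PiLp.norm_eq_ciSup]; exact hi⟩

/-- The dual form, for norms whose unit ball is the convex hull of the `± b i`: precomposition with
`L` is a contraction of the dual space, where the norm is given by the evaluations at the `b i`. -/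
theorem ContinuousLinearMap.exists_perm_forall_tendsto_comp_pow {ι V : Type*} [Fintype ι]
    [NormedAddCommGroup V] [NormedSpace ℝ V] [FiniteDimensional ℝ V] (b : ι → V)
    (hb : ∀ i, ‖b i‖ ≤ 1) (hspan : ∀ v, ∃ c : ι → ℝ, ∑ i, c i • b i = v ∧ ∑ i, |c i| ≤ ‖v‖)
    (L : V →L[ℝ] V) (hL : ∀ v, ‖L v‖ ≤ ‖v‖) :
    ∃ π : Equiv.Perm ι, ∀ φ : V →L[ℝ] ℝ, ∃ ψ : V →L[ℝ] ℝ,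
      Tendsto (fun k => φ.comp ((L ^ (2 * orderOf π)) ^ k)) atTop (𝓝 ψ) := by
  have hL1 : ‖L‖ ≤ 1 := L.opNorm_le_bound zero_le_one fun v => by simpa using hL v
  have hφb : ∀ (φ : V →L[ℝ] ℝ) i, |φ (b i)| ≤ ‖φ‖ := fun φ i =>
    (φ.le_opNorm (b i)).trans (mul_le_of_le_one_right (norm_nonneg φ) (hb i))
  set D : (V →L[ℝ] ℝ) →L[ℝ] (V →L[ℝ] ℝ) := (ContinuousLinearMap.compL ℝ V V ℝ).flip L
  have hD : ∀ φ, D φ = φ.comp L := fun φ => rfl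
  have hDpow : ∀ m φ, (D ^ m) φ = φ.comp (L ^ m) := by
    intro m
    induction m with
    | zero => intro φ; rfl
    | succ m ih =>
      intro φ
      rw [pow_succ, mul_apply_eq_comp, ih, hD, pow_succ']
      rfl
  obtain ⟨π, hπ⟩ := D.exists_perm_forall_tendsto_pow
    (fun i => ContinuousLinearMap.apply ℝ ℝ (b i)) (fun i φ => hφb φ i)
    (fun φ hφ => by
      have : Nonempty ι := by
        by_contra h
        rw [not_nonempty_iff] at h
        refine hφ (ContinuousLinearMap.ext fun v => ?_)
        obtain ⟨c, rfl, -⟩ := hspan v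
        simp
      obtain ⟨i, hi⟩ := Finite.exists_max fun i => |φ (b i)|
      refine ⟨i, le_antisymm (hφb φ i) (φ.opNorm_le_bound (abs_nonneg _) fun v => ?_)⟩
      obtain ⟨c, hc, hcv⟩ := hspan v
      refine le_trans ?_ (mul_le_mul_of_nonneg_left hcv (abs_nonneg _))
      rw [← hc, map_sum, Finset.mul_sum]
      refine (norm_sum_le _ _).trans (Finset.sum_le_sum fun j _ => ?_)
      rw [map_smul, smul_eq_mul, norm_mul, mul_comm]
      exact mul_le_mul_of_nonneg_right (hi j) (abs_nonneg _))
    fun φ => (φ.opNorm_comp_le L).trans (mul_le_of_le_one_right (norm_nonneg φ) hL1)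
  refine ⟨π, fun φ => ?_⟩
  obtain ⟨ψ, hψ⟩ := hπ φ
  exact ⟨ψ, hψ.congr fun k => by rw [← pow_mul, ← pow_mul, hDpow]⟩

theorem exists_perm_forall_tendsto_pow_of_l1 {n : ℕ}
    (L : PiLp 1 (fun _ : Fin n => ℝ) →L[ℝ] PiLp 1 (fun _ : Fin n => ℝ))
    (hL : ∀ v, ‖L v‖ ≤ ‖v‖) :
    ∃ π : Equiv.Perm (Fin n), ∀ v, ∃ y,
      Tendsto (fun k => ((L ^ (2 * orderOf π)) ^ k) v) atTop (𝓝 y) := by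
  obtain ⟨π, hπ⟩ := L.exists_perm_forall_tendsto_comp_pow
    (fun i => PiLp.basisFun 1 ℝ (Fin n) i) (fun i => by simp)
    (fun v => ⟨v, by simpa using (PiLp.basisFun 1 ℝ (Fin n)).sum_repr v,
      (PiLp.norm_eq_of_L1 v).ge⟩) hL
  choose y hy using fun i => hπ (PiLp.proj 1 (fun _ : Fin n => ℝ) i)
  refine ⟨π, fun v => ⟨WithLp.toLp 1 fun i => y i v, ?_⟩⟩
  have h : ∀ i, Tendsto (fun k => ((L ^ (2 * orderOf π)) ^ k) v i) atTop (𝓝 (y i v)) := fun i =>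
    ((ContinuousLinearMap.apply ℝ ℝ v).continuous.tendsto _).comp (hy i)
  exact ((PiLp.continuous_toLp 1 fun _ : Fin n => ℝ).tendsto _).comp (tendsto_pi_nhds.2 h)

/-! ### Analytic nonexpansive maps -/

theorem AnalyticOnNhd.iterate_univ {V : Type*} [NormedAddCommGroup V] [NormedSpace ℝ V]
    {g : V → V} (hg : AnalyticOnNhd ℝ g Set.univ) (m : ℕ) :
    AnalyticOnNhd ℝ g^[m] Set.univ := by
  induction m with
  | zero => exact analyticOnNhd_id
  | succ m ih => exact ih.comp hg (Set.mapsTo_univ _ _)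

theorem norm_iterate_sub_le {V : Type*} [NormedAddCommGroup V] {g : V → V}
    (hg : ∀ x y, ‖g x - g y‖ ≤ ‖x - y‖) (m : ℕ) (x y : V) :
    ‖g^[m] x - g^[m] y‖ ≤ ‖x - y‖ := by
  induction m generalizing x y with
  | zero => rfl
  | succ m ih => exact (ih _ _).trans (hg x y)

/-- An analytic 1-Lipschitz function that grows at unit rate between two points of a line does so on
the whole line. -/
theorem add_smul_eq_of_analytic_of_nonexpansive {V : Type*} [NormedAddCommGroup V] [NormedSpace ℝ V]
    {F : V → ℝ} (hF : AnalyticOnNhd ℝ F Set.univ)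
    (hlip : ∀ x y, F x - F y ≤ ‖x - y‖) {x u : V} (hu : ‖u‖ = 1) {δ : ℝ} (hδ : 0 < δ)
    (h : F (x + δ • u) = F x + δ) (s : ℝ) : F (x + s • u) = F x + s := by
  have h1 : AnalyticOnNhd ℝ (fun s : ℝ => F (x + s • u)) Set.univ :=
    hF.comp (analyticOnNhd_const.add (analyticOnNhd_id.smul analyticOnNhd_const))
      (Set.mapsTo_univ _ _)
  have h2 : AnalyticOnNhd ℝ (fun s : ℝ => F x + s) Set.univ :=
    analyticOnNhd_const.add analyticOnNhd_id
  refine congrFun (h1.eq_of_eventuallyEq h2 (z₀ := δ / 2) ?_) s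
  filter_upwards [Icc_mem_nhds (half_pos hδ) (half_lt_self hδ)] with t ht
  have ha := hlip (x + t • u) x
  have hb := hlip (x + δ • u) (x + t • u)
  rw [add_sub_cancel_left, norm_smul, hu, Real.norm_of_nonneg ht.1] at ha
  rw [add_sub_add_left_eq_sub, ← sub_smul, norm_smul, hu,
    Real.norm_of_nonneg (sub_nonneg.2 ht.2)] at hb
  linarith

/-- A 1-Lipschitz function that increases by `‖w‖` from `p` to `p + w` does so at constant rate along
the segment, so its derivative at `p` norms `w`. -/
theorem HasFDerivAt.apply_eq_norm_of_nonexpansive {V : Type*}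
    [NormedAddCommGroup V] [NormedSpace ℝ V]
    {F : V → ℝ} {F' : V →L[ℝ] ℝ} {p w : V}
    (hF' : HasFDerivAt F F' p) (hlip : ∀ x y, F x - F y ≤ ‖x - y‖)
    (h : F (p + w) = F p + ‖w‖) : F' w = ‖w‖ := by
  have h1 : HasDerivAt (fun t : ℝ => F (p + t • w)) (F' w) 0 := by
    have hc : HasDerivAt (fun t : ℝ => p + t • w) w 0 := by
      simpa using ((hasDerivAt_id (0 : ℝ)).smul_const w).const_add p
    refine HasFDerivAt.comp_hasDerivAt (0 : ℝ) ?_ hc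
    simpa using hF'
  have h2 : HasDerivWithinAt (fun t : ℝ => F p + t * ‖w‖) ‖w‖ (Set.Icc 0 1) 0 := by
    simpa using (((hasDerivAt_id (0 : ℝ)).mul_const ‖w‖).const_add (F p)).hasDerivWithinAt
  have heq : ∀ t ∈ Set.Icc (0 : ℝ) 1, F (p + t • w) = F p + t * ‖w‖ := by
    intro t ht
    have ha := hlip (p + t • w) p
    have hb := hlip (p + w) (p + t • w)
    rw [add_sub_cancel_left, norm_smul, Real.norm_of_nonneg ht.1] at ha
    have : w - t • w = (1 - t) • w := by rw [sub_smul, one_smul]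
    rw [add_sub_add_left_eq_sub, this, norm_smul, Real.norm_of_nonneg (sub_nonneg.2 ht.2)] at hb
    linarith
  exact (uniqueDiffOn_Icc zero_lt_one 0 (by simp)).eq_deriv _ h1.hasDerivWithinAt
    (h2.congr heq (by simp))

/-- For a polyhedral norm, the asymptotics of the norm along a ray are attained: the functional is
one that is largest at `w` among those that norm `u`. -/
theorem exists_eventually_norm_add_smul_eq {V : Type*} [NormedAddCommGroup V] [NormedSpace ℝ V]
    {E : Set (V →L[ℝ] ℝ)} (hE : E.Finite)
    (hle : ∀ φ ∈ E, ∀ x, φ x ≤ ‖x‖) (hatt : ∀ x, ∃ φ ∈ E, φ x = ‖x‖) {u : V} (hu : ‖u‖ = 1)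
    (w : V) : ∃ φ ∈ E, φ u = 1 ∧ ∀ᶠ s : ℝ in atTop, ‖w + s • u‖ = φ w + s := by
  obtain ⟨χ, hχ, hχu⟩ := hatt u
  obtain ⟨φ, ⟨hφ, hφu⟩, hmax⟩ := Set.exists_max_image {φ ∈ E | φ u = 1} (fun φ => φ w)
    (hE.subset fun _ h => h.1) ⟨χ, hχ, hχu.trans hu⟩
  refine ⟨φ, hφ, hφu, ?_⟩
  have : ∀ᶠ s : ℝ in atTop, ∀ ψ ∈ E, ψ (w + s • u) ≤ φ w + s := by
    refine (eventually_all_finite hE).2 fun ψ hψ => ?_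
    by_cases h1 : ψ u = 1
    · exact Eventually.of_forall fun s => by simpa [h1] using hmax ψ ⟨hψ, h1⟩
    · have hlt : 0 < 1 - ψ u := sub_pos.2 (lt_of_le_of_ne (hu ▸ hle ψ hψ u) h1)
      filter_upwards [(tendsto_id.const_mul_atTop hlt).eventually_ge_atTop (ψ w - φ w)] with s hs
      simp only [id] at hs
      simp only [map_add, map_smul, smul_eq_mul]
      linarith
  filter_upwards [this] with s hs
  obtain ⟨ψ, hψ, hψs⟩ := hatt (w + s • u)
  refine le_antisymm (hψs ▸ hs ψ hψ) ?_
  simpa [hφu] using hle φ hφ (w + s • u)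

/-- A recurrent orbit of `g` with steps of constant length is constant, as soon as the powers of the
derivative of `g` at a fixed point converge. -/
theorem eq_zero_of_forall_norm_step_eq_of_recurrent {V : Type*}
    [NormedAddCommGroup V] [NormedSpace ℝ V]
    {E : Set (V →L[ℝ] ℝ)} (hE : E.Finite)
    (hle : ∀ φ ∈ E, ∀ x, φ x ≤ ‖x‖) (hatt : ∀ x, ∃ φ ∈ E, φ x = ‖x‖)
    {g : V → V} (hana : AnalyticOnNhd ℝ g Set.univ) (hg : ∀ x y, ‖g x - g y‖ ≤ ‖x - y‖)
    {p : V} (hp : g p = p) {B : V →L[ℝ] V} (hB : HasFDerivAt g B p)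
    (hconv : ∀ v, ∃ y, Tendsto (fun k => (B ^ k) v) atTop (𝓝 y))
    {x : V} {θ : ℕ → ℕ} (hθ : Tendsto θ atTop atTop)
    (hx : Tendsto (fun i => g^[θ i] x) atTop (𝓝 x))
    {δ : ℝ} (hstep : ∀ k, ‖g^[k + 1] x - g^[k] x‖ = δ) : δ = 0 := by
  by_contra hδ0
  have hδ : 0 < δ := lt_of_le_of_ne (hstep 0 ▸ norm_nonneg _) (Ne.symm hδ0)
  set z : ℕ → V := fun k => g^[k] x with hz
  set u : ℕ → V := fun k => δ⁻¹ • (z (k + 1) - z k) with hu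
  have hδu : ∀ k, δ • u k = z (k + 1) - z k := fun k => smul_inv_smul₀ hδ0 _
  have hun : ∀ k, ‖u k‖ = 1 := fun k => by
    rw [hu, norm_smul, hstep, norm_inv, Real.norm_of_nonneg hδ.le, inv_mul_cancel₀ hδ0]
  have hgz : ∀ m k, g^[m] (z k) = z (k + m) := fun m k => by
    rw [hz, ← Function.iterate_add_apply, add_comm]
  have hgp : ∀ m, g^[m] p = p := fun m => Function.iterate_fixed hp m
  have hlip : ∀ φ ∈ E, ∀ m a b, φ (g^[m] a) - φ (g^[m] b) ≤ ‖a - b‖ := fun φ hφ m a b => by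
    rw [← map_sub]
    exact (hle φ hφ _).trans (norm_iterate_sub_le hg m a b)
  -- Rigidity: analyticity extends the isometric segment `[z k, z (k + 1)]` to a whole line.
  have hline : ∀ m k, ∀ φ ∈ E, φ (u (k + m)) = 1 → ∀ s : ℝ,
      φ (g^[m] (z k + s • u k)) = φ (z (k + m)) + s := by
    intro m k φ hφ hφu s
    have := add_smul_eq_of_analytic_of_nonexpansive (F := fun v => φ (g^[m] v))
      ((φ.analyticOnNhd Set.univ).comp (hana.iterate_univ m) (Set.mapsTo_univ _ _))
      (hlip φ hφ m) (x := z k) (hun k) hδ (by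
        have h1 : φ (z (k + m + 1) - z (k + m)) = δ := by
          rw [← hδu, map_smul, hφu, smul_eq_mul, mul_one]
        rw [map_sub] at h1
        rw [hδu, add_sub_cancel, hgz, hgz, add_right_comm]
        linarith) s
    rw [this, hgz]
  choose Φ hΦE hΦu hΦn using fun k =>
    exists_eventually_norm_add_smul_eq hE hle hatt (hun k) (z k - p)
  have hmono : ∀ k m, ∀ ψ ∈ E, ψ (u (k + m)) = 1 → ψ (z (k + m) - p) ≤ Φ k (z k - p) := by
    intro k m ψ hψ hψu
    obtain ⟨s, hs⟩ := (hΦn k).exists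
    have h1 := hlip ψ hψ m (z k + s • u k) p
    rw [hline m k ψ hψ hψu, hgp, add_sub_right_comm (z k), hs] at h1
    rw [map_sub]
    linarith
  -- By recurrence the levels `Φ k (z k - p)` do not drop after an index with a minimal face.
  obtain ⟨k₀, hk₀⟩ : ∃ k₀, ∀ k, {φ ∈ E | φ (u k₀) = 1}.ncard ≤ {φ ∈ E | φ (u k) = 1}.ncard := by
    exact ⟨_, fun k => Function.argmin_le (fun k => {φ ∈ E | φ (u k) = 1}.ncard) k⟩
  have hgc : Continuous g := continuous_iff_continuousAt.2 fun v =>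
    (hana v (Set.mem_univ _)).continuousAt
  have hzlim : ∀ k, Tendsto (fun i => z (θ i + k)) atTop (𝓝 (z k)) := fun k =>
    (((hgc.iterate k).tendsto x).comp hx).congr fun i => hgz k (θ i)
  have hulim : Tendsto (fun i => u (θ i + k₀)) atTop (𝓝 (u k₀)) :=
    ((hzlim (k₀ + 1)).sub (hzlim k₀)).const_smul δ⁻¹
  have hface : ∀ᶠ i in atTop, Φ k₀ (u (θ i + k₀)) = 1 := by
    have hsub : ∀ᶠ i in atTop, ∀ φ ∈ E, φ (u (θ i + k₀)) = 1 → φ (u k₀) = 1 := by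
      refine (eventually_all_finite hE).2 fun φ _ => ?_
      by_cases h : φ (u k₀) = 1
      · simp [h]
      · filter_upwards [((φ.continuous.tendsto _).comp hulim).eventually_ne h] with i hi h'
        exact absurd h' hi
    filter_upwards [hsub] with i hi
    have : {φ ∈ E | φ (u (θ i + k₀)) = 1} = {φ ∈ E | φ (u k₀) = 1} :=
      Set.eq_of_subset_of_ncard_le (fun φ h => ⟨h.1, hi φ h.1 h.2⟩) (hk₀ _)
        (hE.subset fun _ h => h.1)
    exact (this.symm ▸ ⟨hΦE k₀, hΦu k₀⟩ : Φ k₀ ∈ {φ ∈ E | φ (u (θ i + k₀)) = 1}).2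
  have hconst : ∀ k, k₀ ≤ k → Φ k (z k - p) = Φ k₀ (z k₀ - p) := by
    intro k hk
    refine le_antisymm ?_ ?_
    · obtain ⟨m, rfl⟩ := Nat.exists_eq_add_of_le hk
      exact hmono k₀ m _ (hΦE _) (hΦu _)
    · refine le_of_tendsto (((Φ k₀).continuous.tendsto _).comp ((hzlim k₀).sub_const p)) ?_
      filter_upwards [hface, hθ.eventually_ge_atTop k] with i hi hik
      obtain ⟨m, hm⟩ := Nat.exists_eq_add_of_le (hik.trans (Nat.le_add_right _ k₀))
      rw [hm] at hi
      simp only [Function.comp_apply, hm]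
      exact hmono k m _ (hΦE _) hi
  -- Constant levels make `Φ (k + m)` norming along `g^[m]` from `p`, hence for its derivative.
  have hderiv : ∀ k m, k₀ ≤ k → Φ (k + m) ((B ^ m) (u k)) = 1 := by
    intro k m hk
    have hlev : Φ (k + m) (z (k + m) - p) = Φ k (z k - p) := by
      rw [hconst _ (hk.trans (Nat.le_add_right _ _)), hconst _ hk]
    have hs : ∀ᶠ s : ℝ in atTop,
        Φ (k + m) ((B ^ m) (z k - p + s • u k)) = Φ k (z k - p) + s := by
      filter_upwards [hΦn k] with s hs
      have hd : HasFDerivAt (fun v => Φ (k + m) (g^[m] v)) ((Φ (k + m)).comp (B ^ m)) p :=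
        (Φ (k + m)).hasFDerivAt.comp p (hB.iterate hp m)
      rw [← hs]
      refine hd.apply_eq_norm_of_nonexpansive (hlip _ (hΦE _) m) ?_
      have : p + (z k - p + s • u k) = z k + s • u k := by abel
      rw [this, hline m k _ (hΦE _) (hΦu _), hgp, hs, ← hlev, map_sub]
      ring
    obtain ⟨s, hs1, hs2⟩ :=
      (hs.and ((tendsto_atTop_add_const_right atTop (1 : ℝ) tendsto_id).eventually hs)).exists
    simp only [id, map_add, map_smul, smul_eq_mul] at hs1 hs2
    linarith
  choose P hP using hconv
  obtain ⟨φ, hφE, hφ⟩ : ∃ φ ∈ E, ∃ᶠ K in atTop, Φ K = φ := by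
    have : Finite E := hE
    obtain ⟨φ, hφ⟩ := frequently_exists.1
      (Eventually.of_forall fun K => ⟨⟨Φ K, hΦE K⟩, rfl⟩ :
        ∀ᶠ K in atTop, ∃ φ : E, Φ K = φ).frequently
    exact ⟨φ, φ.2, hφ⟩
  have hφP : ∀ k, k₀ ≤ k → φ (P (u k)) = 1 := by
    intro k hk
    refine tendsto_nhds_unique_of_frequently_eq
      (((φ.continuous.tendsto _).comp (hP (u k))).comp (tendsto_sub_atTop_nat k))
      (tendsto_const_nhds (x := (1 : ℝ))) ?_
    refine (hφ.and_eventually (eventually_ge_atTop k)).mono ?_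
    rintro K ⟨rfl, hK⟩
    have := hderiv k (K - k) hk
    rwa [Nat.add_sub_cancel' hK] at this
  have hPstep : ∀ k, k₀ ≤ k → φ (P (z (k + 1) - p)) = φ (P (z k - p)) + δ := by
    intro k hk
    have : P (z (k + 1) - p) = P (z k - p) + δ • P (u k) :=
      tendsto_nhds_unique (hP _) <| ((hP _).add ((hP _).const_smul δ)).congr fun m => by
        rw [← map_smul, hδu, ← map_add]
        congr 1
        abel
    rw [this, map_add, map_smul, hφP k hk, smul_eq_mul, mul_one]
  have hgrow : ∀ j : ℕ, φ (P (z (k₀ + j) - p)) = φ (P (z k₀ - p)) + j * δ := by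
    intro j
    induction j with
    | zero => simp
    | succ j ih =>
      rw [← add_assoc, hPstep _ (Nat.le_add_right _ _), ih]
      push_cast
      ring
  have hPn : ∀ v, ‖P v‖ ≤ ‖v‖ := fun v => by
    refine le_of_tendsto (hP v).norm (Eventually.of_forall fun m => ?_)
    have hB1 : ‖B ^ m‖ ≤ 1 := by
      have := (hB.iterate hp m).le_of_lipschitz (C := 1)
        (LipschitzWith.of_dist_le_mul fun a b => by
          simpa [dist_eq_norm] using norm_iterate_sub_le hg m a b)
      simpa using this
    simpa using (B ^ m).le_of_opNorm_le hB1 v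
  obtain ⟨j, hj⟩ := exists_nat_gt ((‖x - p‖ - φ (P (z k₀ - p))) / δ)
  rw [div_lt_iff₀ hδ] at hj
  have hbound : φ (P (z (k₀ + j) - p)) ≤ ‖x - p‖ := calc
    _ ≤ ‖z (k₀ + j) - p‖ := (hle φ hφE _).trans (hPn _)
    _ = ‖g^[k₀ + j] x - g^[k₀ + j] p‖ := by rw [hgp]
    _ ≤ _ := norm_iterate_sub_le hg _ _ _
  rw [hgrow] at hbound
  linarith

/-- Convergence of the powers of the derivative at one fixed point makes every orbit converge: a
cluster point is recurrent with steps of constant length, hence fixed, and the distance to a fixed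
point does not increase along an orbit. -/
theorem exists_tendsto_iterate_of_tendsto_pow_fderiv {V : Type*}
    [NormedAddCommGroup V] [NormedSpace ℝ V] [FiniteDimensional ℝ V]
    {E : Set (V →L[ℝ] ℝ)} (hE : E.Finite)
    (hle : ∀ φ ∈ E, ∀ x, φ x ≤ ‖x‖) (hatt : ∀ x, ∃ φ ∈ E, φ x = ‖x‖)
    {g : V → V} (hana : AnalyticOnNhd ℝ g Set.univ) (hg : ∀ x y, ‖g x - g y‖ ≤ ‖x - y‖)
    {p : V} (hp : g p = p) {B : V →L[ℝ] V} (hB : HasFDerivAt g B p)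
    (hconv : ∀ v, ∃ y, Tendsto (fun k => (B ^ k) v) atTop (𝓝 y)) (x : V) :
    ∃ ξ, Tendsto (fun k => g^[k] x) atTop (𝓝 ξ) ∧ g ξ = ξ := by
  have : ProperSpace V := FiniteDimensional.proper ℝ V
  have hgc : Continuous g := continuous_iff_continuousAt.2 fun v =>
    (hana v (Set.mem_univ _)).continuousAt
  obtain ⟨ξ, -, θ, hθ, hξ⟩ := tendsto_subseq_of_bounded
    (Metric.isBounded_closedBall (x := p) (r := ‖x - p‖)) (x := fun k => g^[k] x) fun k => by
      have := norm_iterate_sub_le hg k x p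
      rwa [Function.iterate_fixed hp, ← mem_closedBall_iff_norm] at this
  have hlim : ∀ k, Tendsto (fun i => g^[θ i + k] x) atTop (𝓝 (g^[k] ξ)) := fun k =>
    (((hgc.iterate k).tendsto ξ).comp hξ).congr fun i => by
      simp [← Function.iterate_add_apply, add_comm]
  have hanti : Antitone fun k => ‖g^[k + 1] x - g^[k] x‖ := antitone_nat_of_succ_le fun k => by
    simp only [Function.iterate_succ_apply' g]
    exact hg _ _
  have hδ := tendsto_atTop_ciInf hanti ⟨0, by rintro _ ⟨k, rfl⟩; exact norm_nonneg _⟩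
  have hstep : ∀ k, ‖g^[k + 1] ξ - g^[k] ξ‖ = ⨅ k, ‖g^[k + 1] x - g^[k] x‖ := fun k =>
    tendsto_nhds_unique ((hlim (k + 1)).sub (hlim k)).norm
      (hδ.comp ((tendsto_add_atTop_nat k).comp hθ.tendsto_atTop))
  -- `ξ` is recurrent: `g^[θ (2 * i) - θ i] ξ` tends to `ξ`.
  have hgap : ∀ i, i ≤ θ (2 * i) - θ i := fun i => by
    have := hθ.add_le_nat i i
    rw [← two_mul] at this
    omega
  have hrec : Tendsto (fun i => g^[θ (2 * i) - θ i] ξ) atTop (𝓝 ξ) := by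
    have h2 : Tendsto (fun i => g^[θ (2 * i)] x) atTop (𝓝 ξ) :=
      hξ.comp (tendsto_id.const_mul_atTop' two_pos)
    have h0 : Tendsto (fun i => g^[θ (2 * i) - θ i] ξ - g^[θ (2 * i)] x) atTop (𝓝 0) := by
      refine squeeze_zero_norm (a := fun i => ‖ξ - g^[θ i] x‖) (fun i => ?_) ?_
      · have h : g^[θ (2 * i)] x = g^[θ (2 * i) - θ i] (g^[θ i] x) := by
          rw [← Function.iterate_add_apply, Nat.sub_add_cancel (hθ.monotone (by omega))]
        rw [h]
        exact norm_iterate_sub_le hg _ _ _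
      · simpa using ((tendsto_const_nhds (x := ξ)).sub hξ).norm
    simpa using h0.add h2
  have h0 := eq_zero_of_forall_norm_step_eq_of_recurrent hE hle hatt hana hg hp hB hconv
    (tendsto_atTop_mono hgap tendsto_id) hrec hstep
  have hfix : g ξ = ξ := sub_eq_zero.1 (norm_eq_zero.1 ((hstep 0).trans h0))
  refine ⟨ξ, tendsto_of_antitone_of_subseq (antitone_nat_of_succ_le fun k => ?_) hξ, hfix⟩
  calc _ = ‖g (g^[k] x) - g ξ‖ := by rw [hfix, Function.iterate_succ_apply']
    _ ≤ _ := hg _ _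

/-! ### The two norms and the theorem -/

/-- The norm of `ℓ¹` or `ℓ^∞` is the maximum of finitely many functionals, all of them with
coefficients `0`, `1` or `-1`. -/
theorem exists_finite_norming_set {n : ℕ} {p : ℝ≥0∞} [Fact (1 ≤ p)] (hp : p = 1 ∨ p = ∞) :
    ∃ E : Set (PiLp p (fun _ : Fin n => ℝ) →L[ℝ] ℝ), E.Finite ∧
      (∀ φ ∈ E, ∀ x, φ x ≤ ‖x‖) ∧ ∀ x, ∃ φ ∈ E, φ x = ‖x‖ := by
  set S : (Fin n → SignType) → (PiLp p (fun _ : Fin n => ℝ) →L[ℝ] ℝ) := fun σ =>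
    ∑ i, (σ i : ℝ) • PiLp.proj p (fun _ : Fin n => ℝ) i
  have hS : ∀ σ x, S σ x = ∑ i, (σ i : ℝ) * x i := fun σ x => by
    simp [S]
  refine ⟨{φ ∈ Set.range S | ∀ x, φ x ≤ ‖x‖}, (Set.finite_range S).subset fun _ h => h.1,
    fun φ h => h.2, fun x => ?_⟩
  rcases hp with rfl | rfl
  · refine ⟨S fun i => SignType.sign (x i), ⟨⟨_, rfl⟩, fun v => ?_⟩, ?_⟩
    · rw [hS, PiLp.norm_eq_of_L1]
      refine Finset.sum_le_sum fun i _ => (le_abs_self _).trans ?_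
      rw [abs_mul, Real.norm_eq_abs]
      refine mul_le_of_le_one_left (abs_nonneg _) ?_
      rcases SignType.trichotomy (SignType.sign (x i)) with h | h | h <;> simp [h]
    · rw [hS, PiLp.norm_eq_of_L1]
      exact Finset.sum_congr rfl fun i _ => sign_mul_self (x i)
  · rcases isEmpty_or_nonempty (Fin n) with h | h
    · exact ⟨S 0, ⟨⟨_, rfl⟩, fun v => by simp [hS]⟩, by simp [hS, PiLp.norm_eq_ciSup]⟩
    obtain ⟨i, hi⟩ := exists_eq_ciSup_of_finite (f := fun i => ‖x i‖)
    have hval : ∀ v, S (Pi.single i (SignType.sign (x i))) v = SignType.sign (x i) * v i := by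
      intro v
      rw [hS, Finset.sum_eq_single i (fun j _ hj => by simp [hj]) (by simp), Pi.single_eq_same]
    refine ⟨S (Pi.single i (SignType.sign (x i))), ⟨⟨_, rfl⟩, fun v => ?_⟩, ?_⟩
    · rw [hval]
      refine (le_abs_self _).trans ((?_ : _ ≤ |v i|).trans (PiLp.norm_apply_le v i))
      rw [abs_mul]
      refine mul_le_of_le_one_left (abs_nonneg _) ?_
      rcases SignType.trichotomy (SignType.sign (x i)) with h | h | h <;> simp [h]
    · rw [hval, sign_mul_self, PiLp.norm_eq_ciSup, ← hi, Real.norm_eq_abs]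

theorem theorem3p1 (n : ℕ) (p : ℝ≥0∞) [Fact (1 ≤ p)] (hp : p = 1 ∨ p = ∞)
    (f : PiLp p (fun _ : Fin n => ℝ) → PiLp p (fun _ : Fin n => ℝ))
    (hf_analytic : AnalyticOnNhd ℝ f Set.univ)
    (hf_nonexp : ∀ x y, ‖f x - f y‖ ≤ ‖x - y‖)
    (hf_fix : (Function.fixedPoints f).Nonempty) :
    ∃ q : ℕ, 0 < q ∧
      (∀ x, ∃ ξ, Tendsto (fun k : ℕ => f^[k * q] x) atTop (𝓝 ξ) ∧
        ξ ∈ Function.periodicPts f ∧ Function.minimalPeriod f ξ ∣ q) ∧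
      ∃ π : Equiv.Perm (Fin n), q = orderOf π ∨ q = 2 * orderOf π := by
  obtain ⟨v, hv⟩ := hf_fix
  obtain ⟨E, hE, hle, hatt⟩ := exists_finite_norming_set (n := n) hp
  have hA : HasFDerivAt f (fderiv ℝ f v) v :=
    (hf_analytic v (Set.mem_univ _)).differentiableAt.hasFDerivAt
  have hAle : ∀ w, ‖fderiv ℝ f v w‖ ≤ ‖w‖ := fun w => by
    have h : ‖fderiv ℝ f v‖ ≤ 1 := by
      simpa using norm_fderiv_le_of_lipschitz ℝ (x₀ := v) (C := 1) <|
        LipschitzWith.of_dist_le_mul fun a b => by simpa [dist_eq_norm] using hf_nonexp a b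
    simpa using (fderiv ℝ f v).le_of_opNorm_le h w
  obtain ⟨π, hπ⟩ : ∃ π : Equiv.Perm (Fin n), ∀ w, ∃ y,
      Tendsto (fun k => ((fderiv ℝ f v ^ (2 * orderOf π)) ^ k) w) atTop (𝓝 y) := by
    rcases hp with rfl | rfl
    · exact exists_perm_forall_tendsto_pow_of_l1 _ hAle
    · exact exists_perm_forall_tendsto_pow_of_linfty _ hAle
  have hq : 0 < 2 * orderOf π := Nat.mul_pos two_pos (orderOf_pos π)
  refine ⟨2 * orderOf π, hq, fun x => ?_, π, Or.inr rfl⟩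
  obtain ⟨ξ, hξ, hfix⟩ := exists_tendsto_iterate_of_tendsto_pow_fderiv hE hle hatt
    (hf_analytic.iterate_univ _) (norm_iterate_sub_le hf_nonexp _) (Function.iterate_fixed hv _)
    (hA.iterate hv (2 * orderOf π)) hπ x
  have hper : Function.IsPeriodicPt f (2 * orderOf π) ξ := hfix
  refine ⟨ξ, hξ.congr fun k => ?_, ⟨_, hq, hper⟩, hper.minimalPeriod_dvd⟩
  rw [mul_comm k, Function.iterate_mul f (2 * orderOf π) k]
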